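/- Let $p,q$ be positive integers, $n=p+q$, and $X=\{1,\dots,n\}\cup\{-1,\dots,-n\}$. Let $B_n$ be the hyperoctahedral group, i.e. the group of permutations $\tau$ of $X$ such that $\tau(-i)=-\tau(i)$ for all $i$, and let $$\gamma=(1,\dots,p,-1,\dots,-p)\,(p+1,\dots,n,-(p+1),\dots,-n)\in B_n .$$ For permutations $\tau,\sigma$ of $X$ let $\#(\tau)$ be the number of orbits of $\tau$ on $X$ (fixed points included), and $\#(\tau,\sigma)$ the number of orbits on $X$ of the group generated by $\tau$ and $\sigma$. Let $$\mathcal S_{nc}(X,\gamma)=\{\tau\in\mathcal S(X)\mid \#(\tau)+\#(\tau^{-1}\gamma)+\#(\gamma)=|X|+2\,\#(\tau,\gamma)\}$$ be the set of non-crossing (genus zero) permutations of $X$ with respect to $\gamma$, where $\mathcal S(X)$ is the group of all permutations of $X$, and let $\mathcal S^B_{nc}(p,q)=\mathcal S_{nc}(X,\gamma)\cap B_n$ be the set of annular non-crossing permutations of type B. For $\tau\in B_n$ let $\ell_B(\tau)$ be the least $k\ge 0$ such that $\tau$ is a product of $k$ elements of $$\{(i,j)(-i,-j)\mid 1\le i<j\le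 n\}\cup\{(i,-j)(-i,j)\mid 1\le i<j\le n\}\cup\{(i,-i)\mid 1\le i\le n\},$$ and for $\sigma,\tau\in B_n$ write $\sigma\le\tau$ if $\ell_B(\tau)=\ell_B(\sigma)+\ell_B(\sigma^{-1}\tau)$. **Theorem 1.1.** $\mathcal S^B_{nc}(p,q)=\{\tau\in B_n\mid \tau\le\gamma\}$. -/

import Mathlib

open Equiv

/-- The finite set `{1, …, n} ∪ {-1, …, -n}`. -/
def SignedPt (n : ℕ) : Type := {i : ℤ // i ≠ 0 ∧ |i| ≤ (n : ℤ)}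

namespace SignedPt

instance (n : ℕ) : DecidableEq (SignedPt n) :=
  inferInstanceAs (DecidableEq {i : ℤ // i ≠ 0 ∧ |i| ≤ (n : ℤ)})

/-- The inversion `i ↦ -i`. -/
instance (n : ℕ) : InvolutiveNeg (SignedPt n) where
  neg i := ⟨-i.1, neg_ne_zero.mpr i.2.1, by rw [abs_neg]; exact i.2.2⟩
  neg_neg i := Subtype.ext (neg_neg i.1)

/-- The points `1, …, n`, indexed from zero: `k : Fin n` gives the point `k + 1`. -/
def pos {n : ℕ} (k : Fin n) : SignedPt n :=
  ⟨(k : ℤ) + 1, by omega, by have := k.2; rw [abs_of_nonneg (by omega)]; omega⟩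

end SignedPt

/-- The hyperoctahedral group `B_n`: permutations with `τ (-i) = -τ i`. -/
def hyperoctahedral (n : ℕ) : Subgroup (Perm (SignedPt n)) where
  carrier := {τ | ∀ i, τ (-i) = -τ i}
  one_mem' _ := rfl
  mul_mem' {σ τ} hσ hτ i := by
    rw [Perm.mul_apply, Perm.mul_apply, hτ i, hσ (τ i)]
  inv_mem' {τ} hτ i := by
    rw [Perm.inv_eq_iff_eq, hτ, ← Perm.mul_apply, mul_inv_cancel, Perm.one_apply]

/-- The generators `(i, j)(-i, -j)` and `(i, -j)(-i, j)` for `1 ≤ i < j ≤ n`, and `(i, -i)` for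
`1 ≤ i ≤ n`, of `B_n`. -/
def reflectionsB (n : ℕ) : Set (hyperoctahedral n) :=
  {g | ∃ i j : SignedPt n, 0 < i.1 ∧ i.1 < j.1 ∧
      (g : Perm (SignedPt n)) = swap i j * swap (-i) (-j)} ∪
  {g | ∃ i j : SignedPt n, 0 < i.1 ∧ i.1 < j.1 ∧
      (g : Perm (SignedPt n)) = swap i (-j) * swap (-i) j} ∪
  {g | ∃ i : SignedPt n, 0 < i.1 ∧ (g : Perm (SignedPt n)) = swap i (-i)}

/-- The length `ℓ_B`: the least `k` such that `τ` is a product of `k` of the generators. -/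
noncomputable def lengthB {n : ℕ} (τ : hyperoctahedral n) : ℕ :=
  sInf {k | ∃ l : List (hyperoctahedral n),
    l.length = k ∧ (∀ g ∈ l, g ∈ reflectionsB n) ∧ l.prod = τ}

/-- The order on `B_n`: `σ ≤ τ` when `ℓ_B(τ) = ℓ_B(σ) + ℓ_B(σ⁻¹τ)`. -/
def absLEB {n : ℕ} (σ τ : hyperoctahedral n) : Prop :=
  lengthB τ = lengthB σ + lengthB (σ⁻¹ * τ)

/-- The number of orbits on `X` of a group of permutations of `X`. -/
noncomputable def numOrbits {X : Type*} (H : Subgroup (Perm X)) : ℕ :=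
  Nat.card (MulAction.orbitRel.Quotient H X)

/-- The number `#(τ)` of orbits (fixed points included) of a permutation. -/
noncomputable def numCycles {X : Type*} (τ : Perm X) : ℕ :=
  numOrbits (Subgroup.zpowers τ)

/-- The permutations of the finite set `X` that are non-crossing with respect to `γ`: those for
which the genus vanishes, that is, `#(τ) + #(τ⁻¹γ) + #(γ) = |X| + 2 #(τ, γ)`, where `#(τ, γ)`
counts the orbits of the group generated by `τ` and `γ`. -/
def nonCrossing {X : Type*} [Finite X] (γ : Perm X) : Set (Perm X) :=
  {τ | numCycles τ + numCycles (τ⁻¹ * γ) + numCycles γ =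
    Nat.card X + 2 * numOrbits (Subgroup.closure {τ, γ})}

instance (n : ℕ) : Finite (SignedPt n) :=
  Finite.of_injective
    (fun i : SignedPt n => (⟨i.1, abs_le.mp i.2.2⟩ : Set.Icc (-(n : ℤ)) n))
    fun _ _ h => Subtype.ext (congrArg (fun x : Set.Icc (-(n : ℤ)) n => x.1) h)

/-- For `l = [a₁, …, a_r]`, the cyclic permutation `(a₁, …, a_r, -a₁, …, -a_r)`. -/
def signedCycle {n : ℕ} (l : List (SignedPt n)) : Perm (SignedPt n) :=
  (l ++ l.map (fun i => -i)).formPerm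

/-- The permutation `γ = (1, …, p, -1, …, -p)(p+1, …, n, -(p+1), …, -n)`, with `n = p + q`. -/
def annularGamma (p q : ℕ) : Perm (SignedPt (p + q)) :=
  signedCycle ((List.finRange p).map fun k => SignedPt.pos (Fin.castAdd q k)) *
    signedCycle ((List.finRange q).map fun k => SignedPt.pos (Fin.natAdd p k))

theorem formPerm_map_neg {n : ℕ} (l : List (SignedPt n)) (i : SignedPt n) :
    (l.map (fun j => -j)).formPerm (-i) = -(l.formPerm i) := by
  induction l using List.twoStepInduction generalizing i with
  | nil => rfl
  | singleton a => rfl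
  | cons_cons a b l _ ih =>
    have h := ih b i
    simp only [List.map_cons] at h
    simp only [List.map_cons, List.formPerm_cons_cons, Perm.mul_apply, h]
    simp only [swap_apply_def, neg_inj]
    split_ifs <;> rfl

theorem signedCycle_mem {n : ℕ} {l : List (SignedPt n)} (hl : l.Nodup)
    (hpos : ∀ i ∈ l, 0 < i.1) : signedCycle l ∈ hyperoctahedral n := by
  have hnd : (l ++ l.map (fun i => -i)).Nodup := by
    refine hl.append (hl.map neg_injective) ?_
    intro i hi hi'
    obtain ⟨j, hj, rfl⟩ := List.mem_map.mp hi'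
    have h1 : 0 < -j.1 := hpos _ hi
    have h2 := hpos _ hj
    omega
  intro i
  have h := formPerm_map_neg (l ++ l.map (fun i => -i)) i
  have h2 : (l ++ l.map (fun i => -i)).map (fun j => -j) = l.map (fun i => -i) ++ l := by
    simp
  rw [h2] at h
  unfold signedCycle
  rw [← h, List.formPerm_eq_of_isRotated hnd List.isRotated_append]

theorem SignedPt.pos_injective (n : ℕ) : Function.Injective (SignedPt.pos (n := n)) := by
  intro a b h
  have h' : ((a : ℤ) + 1) = (b : ℤ) + 1 := congrArg (fun x : SignedPt n => x.1) h
  exact Fin.ext (by omega)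

theorem annularGamma_mem (p q : ℕ) : annularGamma p q ∈ hyperoctahedral (p + q) := by
  refine mul_mem (signedCycle_mem ?_ ?_) (signedCycle_mem ?_ ?_)
  · exact (List.nodup_finRange p).map
      ((SignedPt.pos_injective _).comp (Fin.castAdd_injective p q))
  · intro i hi
    obtain ⟨k, -, rfl⟩ := List.mem_map.mp hi
    exact Int.natCast_succ_pos _
  · exact (List.nodup_finRange q).map
      ((SignedPt.pos_injective _).comp (Fin.natAdd_injective q p))
  · intro i hi
    obtain ⟨k, -, rfl⟩ := List.mem_map.mp hi
    exact Int.natCast_succ_pos _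

/-- The set of annular non-crossing permutations of type B. -/
def annularNonCrossingB (p q : ℕ) : Set (Perm (SignedPt (p + q))) :=
  nonCrossing (annularGamma p q) ∩ (hyperoctahedral (p + q) : Set (Perm (SignedPt (p + q))))

/-!
Both conditions are read off from the action of `B_n` on functions `X → ℚ`, which splits into even
functions (`f (-x) = f x`) and odd functions (`f (-x) = -f x`), each of dimension `n`. For `τ` in
`B_n` let `e τ` and `o τ` be the dimensions of its even and odd invariants. Then `#(τ) = e τ + o τ`,
and `e τ - o τ` is the number of balanced cycles, those equal to their own negative.

The odd functions form the reflection representation, so Carter's formula gives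
`ℓ_B(τ) = n - o τ` (`lengthB_add_finrank`). Both cycles of `γ` are balanced, so `o γ = 0`,
`e γ = 2`, and with `τ' = τ⁻¹ γ` the condition `τ ≤ γ` says `o τ + o τ' = n`. The non-crossing condition says
`e τ + o τ + e τ' + o τ' + 2 = 2 n + 2 k`, with `k` the number of orbits of `⟨τ, γ⟩`, which is
1 or 2. Three inequalities make the two equivalent (`mem_nonCrossing_annularGamma_iff`):

* `o τ + o τ' ≤ n`, because a common odd invariant of `τ` and `τ'` is an odd invariant of `γ`;
* `e τ + e τ' + 2 ≤ n + 2 k`, which is the genus inequality for the permutations induced on `X / ±1`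
  and is obtained here as a case of Scott's lemma on invariants (`finrank_invariants_le`);
* `o τ + o τ' + 2 (k - 1) ≤ e τ + e τ'` (`finrank_odd_le_finrank_even`): if `k = 2`, both circles
  are stable, and on each of them `τ` or `τ'` has a balanced cycle, since otherwise both would restrict
  to even permutations there, while `γ` restricts to a cycle of even length.
-/

/-! ### Invariant functions -/

section Invariants

variable {X : Type*}

/-- The space of functions `X → ℚ` that are invariant under every permutation in `S`. -/
def invariants (S : Set (Perm X)) : Submodule ℚ (X → ℚ) where
  carrier := {f | ∀ σ ∈ S, ∀ x, f (σ x) = f x}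
  zero_mem' _ _ _ := rfl
  add_mem' hf hg σ hσ x := by simp [hf σ hσ x, hg σ hσ x]
  smul_mem' c f hf σ hσ x := by simp [hf σ hσ x]

theorem mem_invariants {S : Set (Perm X)} {f : X → ℚ} :
    f ∈ invariants S ↔ ∀ σ ∈ S, ∀ x, f (σ x) = f x := Iff.rfl

theorem mem_invariants_singleton {σ : Perm X} {f : X → ℚ} :
    f ∈ invariants {σ} ↔ ∀ x, f (σ x) = f x := by
  simp [mem_invariants]

theorem mem_invariants_pair {σ τ : Perm X} {f : X → ℚ} :
    f ∈ invariants {σ, τ} ↔ (∀ x, f (σ x) = f x) ∧ ∀ x, f (τ x) = f x := by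
  simp [mem_invariants]

theorem invariants_pair (σ τ : Perm X) :
    invariants {σ, τ} = invariants {σ} ⊓ invariants {τ} := by
  ext f
  simp [mem_invariants]

theorem apply_smul_of_mem_invariants {S : Set (Perm X)} {f : X → ℚ} (hf : f ∈ invariants S)
    {g : Perm X} (hg : g ∈ Subgroup.closure S) (x : X) : f (g x) = f x := by
  induction hg using Subgroup.closure_induction generalizing x with
  | mem σ hσ => exact hf σ hσ x
  | one => rfl
  | mul σ τ _ _ h₁ h₂ => rw [Perm.mul_apply, h₁, h₂]
  | inv σ _ h => rw [← h, ← Perm.mul_apply, mul_inv_cancel, Perm.one_apply]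

/-- The quotient of `X` by the orbits of the group generated by `S`. -/
abbrev OrbitSpace (S : Set (Perm X)) : Type _ :=
  MulAction.orbitRel.Quotient (Subgroup.closure S) X

/-- The orbit of a point under the group generated by `S`. -/
def orbitMk (S : Set (Perm X)) (x : X) : OrbitSpace S :=
  Quotient.mk (MulAction.orbitRel (Subgroup.closure S) X) x

theorem orbitMk_surjective (S : Set (Perm X)) : Function.Surjective (orbitMk S) :=
  Quotient.mk_surjective

theorem apply_eq_of_orbitMk_eq {S : Set (Perm X)} {f : X → ℚ} (hf : f ∈ invariants S) {x y : X}
    (h : orbitMk S x = orbitMk S y) : f x = f y := by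
  obtain ⟨g, rfl⟩ := MulAction.orbitRel_apply.mp (Quotient.exact h)
  exact apply_smul_of_mem_invariants hf g.2 y

theorem orbitMk_apply {S : Set (Perm X)} {σ : Perm X} (hσ : σ ∈ S) (x : X) :
    orbitMk S (σ x) = orbitMk S x :=
  Quotient.sound (MulAction.orbitRel_apply.mpr ⟨⟨σ, Subgroup.subset_closure hσ⟩, rfl⟩)

theorem invariants_pair_mul (σ τ : Perm X) : invariants {σ, σ * τ} = invariants {σ, τ} := by
  ext f
  rw [mem_invariants_pair, mem_invariants_pair]
  refine and_congr_right fun h => forall_congr' fun x => ?_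
  rw [Perm.mul_apply, h]

theorem invariants_one : invariants {(1 : Perm X)} = ⊤ :=
  eq_top_iff.mpr fun _ _ => mem_invariants_singleton.mpr fun _ => rfl

/-- If a surjection `g` has as fibres exactly the sets on which all `S`-invariant functions are
constant, its target indexes a basis of the space of invariants. -/
theorem finrank_invariants_eq_card {S : Set (Perm X)} {Y : Type*} [Finite Y] {g : X → Y}
    (hg : Function.Surjective g) (hS : ∀ σ ∈ S, ∀ x, g (σ x) = g x)
    (hinv : ∀ f ∈ invariants S, ∀ x y, g x = g y → f x = f y) :
    Module.finrank ℚ (invariants S) = Nat.card Y := by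
  have hrange : (LinearMap.funLeft ℚ ℚ g).range = invariants S := by
    apply le_antisymm
    · rintro _ ⟨f, rfl⟩ σ hσ x
      simp [LinearMap.funLeft_apply, hS σ hσ]
    · intro f hf
      refine ⟨fun y => f (hg y).choose, funext fun x => ?_⟩
      exact hinv f hf _ _ (hg (g x)).choose_spec
  have := Fintype.ofFinite Y
  rw [← hrange,
    LinearMap.finrank_range_of_inj (LinearMap.funLeft_injective_of_surjective ℚ ℚ _ hg),
    Module.finrank_fintype_fun_eq_card, Nat.card_eq_fintype_card]

variable [Finite X]

instance (S : Set (Perm X)) : Finite (OrbitSpace S) :=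
  Finite.of_surjective _ (orbitMk_surjective S)

theorem numOrbits_closure (S : Set (Perm X)) :
    numOrbits (Subgroup.closure S) = Module.finrank ℚ (invariants S) :=
  (finrank_invariants_eq_card (orbitMk_surjective S) (fun _ hσ => orbitMk_apply hσ)
    fun _ hf _ _ => apply_eq_of_orbitMk_eq hf).symm

theorem numCycles_eq_finrank (σ : Perm X) :
    numCycles σ = Module.finrank ℚ (invariants {σ}) := by
  rw [numCycles, Subgroup.zpowers_eq_closure, numOrbits_closure]

/-- Scott's inequality for a space `W` of functions on `X` that is stable under `σ`: if `v` is
invariant under `σ * τ`, then `v ∘ σ - v = v ∘ τ⁻¹ - v` is orthogonal to the invariants of `σ` and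
to those of `τ`, and it vanishes only if `v` is invariant under both. -/
theorem finrank_invariants_le (W : Submodule ℚ (X → ℚ)) (σ τ : Perm X)
    (hW : ∀ f ∈ W, f ∘ σ ∈ W) :
    Module.finrank ℚ ↥(W ⊓ invariants {σ}) + Module.finrank ℚ ↥(W ⊓ invariants {τ}) +
        Module.finrank ℚ ↥(W ⊓ invariants {σ * τ}) ≤
      Module.finrank ℚ W + 2 * Module.finrank ℚ ↥(W ⊓ invariants {σ, τ}) := by
  have := Fintype.ofFinite X
  set A := W ⊓ invariants {σ}
  set B := W ⊓ invariants {τ}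
  set C := W ⊓ invariants {σ * τ}
  have hAB : A ⊓ B = W ⊓ invariants {σ, τ} := by
    rw [invariants_pair]
    exact (inf_inf_distrib_left _ _ _).symm
  let φ : (X → ℚ) →ₗ[ℚ] (X → ℚ) := LinearMap.funLeft ℚ ℚ σ - LinearMap.id
  have hφ (v : X → ℚ) (x : X) : φ v x = v (σ x) - v x := rfl
  have hC {v : X → ℚ} (hv : v ∈ C) (x : X) : v (σ (τ x)) = v x :=
    mem_invariants_singleton.mp hv.2 x
  have hker : (φ.domRestrict C).ker.map C.subtype ≤ A ⊓ B := by
    rintro _ ⟨⟨v, hv⟩, hv0, rfl⟩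
    have h0 (x : X) : v (σ x) = v x := sub_eq_zero.mp (congrFun (LinearMap.mem_ker.mp hv0) x)
    refine ⟨⟨hv.1, mem_invariants_singleton.mpr h0⟩, hv.1, mem_invariants_singleton.mpr fun x => ?_⟩
    exact (h0 (τ x)).symm.trans (hC hv x)
  have hdisj : Disjoint (φ.domRestrict C).range (A ⊔ B) := by
    rw [Submodule.disjoint_def]
    rintro _ ⟨⟨v, hv⟩, rfl⟩ hmem
    obtain ⟨a, ha, b, hb, hab⟩ := Submodule.mem_sup.mp hmem
    have ha' : ∑ x, a x * φ v x = 0 := by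
      simp only [hφ, mul_sub, Finset.sum_sub_distrib, sub_eq_zero]
      rw [← Equiv.sum_comp σ fun x => a x * v x]
      exact Finset.sum_congr rfl fun x _ => by rw [mem_invariants_singleton.mp ha.2]
    have hb' : ∑ x, b x * φ v x = 0 := by
      simp only [hφ, mul_sub, Finset.sum_sub_distrib, sub_eq_zero]
      rw [← Equiv.sum_comp τ fun x => b x * v (σ x)]
      exact Finset.sum_congr rfl fun x _ => by rw [hC hv, mem_invariants_singleton.mp hb.2]
    have hsq : ∑ x, φ v x * φ v x = 0 := by
      have (x : X) : φ v x = a x + b x := (congrFun hab x).symm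
      calc ∑ x, φ v x * φ v x = ∑ x, (a x * φ v x + b x * φ v x) :=
            Finset.sum_congr rfl fun x _ => by rw [← add_mul, ← this]
        _ = 0 := by rw [Finset.sum_add_distrib, ha', hb', add_zero]
    funext x
    exact mul_self_eq_zero.mp
      ((Finset.sum_eq_zero_iff_of_nonneg fun x _ => mul_self_nonneg _).mp hsq x (Finset.mem_univ x))
  have hle : (φ.domRestrict C).range ⊔ (A ⊔ B) ≤ W := by
    refine sup_le ?_ (sup_le inf_le_left inf_le_left)
    rintro _ ⟨⟨v, hv⟩, rfl⟩
    exact W.sub_mem (hW v hv.1) hv.1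
  have h1 := LinearMap.finrank_range_add_finrank_ker (φ.domRestrict C)
  have h2 := Submodule.finrank_mono hker
  rw [Submodule.finrank_map_subtype_eq] at h2
  have h3 := Submodule.finrank_mono hle
  have h4 := Submodule.finrank_sup_add_finrank_inf_eq (φ.domRestrict C).range (A ⊔ B)
  rw [hdisj.eq_bot, finrank_bot] at h4
  have h5 := Submodule.finrank_sup_add_finrank_inf_eq A B
  rw [hAB] at h2 h5
  omega

end Invariants

/-! ### Even and odd functions -/

section Parity

variable {n : ℕ}

/-- The functions `f` on the signed points with `f (-x) = f x`. -/
def evenFunctions (n : ℕ) : Submodule ℚ (SignedPt n → ℚ) :=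
  invariants {Equiv.neg (SignedPt n)}

/-- The functions `f` on the signed points with `f (-x) = -f x`. -/
def oddFunctions (n : ℕ) : Submodule ℚ (SignedPt n → ℚ) where
  carrier := {f | ∀ x, f (-x) = -f x}
  zero_mem' _ := by simp
  add_mem' hf hg x := by simp [hf x, hg x, add_comm]
  smul_mem' c f hf x := by simp [hf x]

theorem mem_evenFunctions {f : SignedPt n → ℚ} : f ∈ evenFunctions n ↔ ∀ x, f (-x) = f x :=
  mem_invariants_singleton

theorem mem_oddFunctions {f : SignedPt n → ℚ} : f ∈ oddFunctions n ↔ ∀ x, f (-x) = -f x :=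
  Iff.rfl

theorem SignedPt.neg_ne (x : SignedPt n) : -x ≠ x := fun h => by
  have h1 : -x.1 = x.1 := congrArg Subtype.val h
  have h2 := x.2.1
  omega

theorem SignedPt.neg_apply_eq (x : SignedPt n) : (Equiv.neg (SignedPt n)) x = -x := rfl

/-- The even functions invariant under `τ`; the dimension is the number of orbits of the
group generated by `τ` and `x ↦ -x`. -/
def evenInvariants (τ : Perm (SignedPt n)) : Submodule ℚ (SignedPt n → ℚ) :=
  evenFunctions n ⊓ invariants {τ}

/-- The odd functions invariant under `τ`. For `τ` in `B_n` the dimension is the number of pairs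
`{c, -c}` of distinct opposite cycles of `τ`. -/
def oddInvariants (τ : Perm (SignedPt n)) : Submodule ℚ (SignedPt n → ℚ) :=
  oddFunctions n ⊓ invariants {τ}

theorem mem_oddInvariants {τ : Perm (SignedPt n)} {f : SignedPt n → ℚ} :
    f ∈ oddInvariants τ ↔ (∀ x, f (-x) = -f x) ∧ ∀ x, f (τ x) = f x := by
  rw [oddInvariants, Submodule.mem_inf, mem_oddFunctions, mem_invariants_singleton]

theorem mem_evenInvariants {τ : Perm (SignedPt n)} {f : SignedPt n → ℚ} :
    f ∈ evenInvariants τ ↔ (∀ x, f (-x) = f x) ∧ ∀ x, f (τ x) = f x := by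
  rw [evenInvariants, Submodule.mem_inf, mem_evenFunctions, mem_invariants_singleton]

theorem finrank_even_add_odd {τ : Perm (SignedPt n)} (hτ : τ ∈ hyperoctahedral n) :
    Module.finrank ℚ (evenInvariants τ) + Module.finrank ℚ (oddInvariants τ) = numCycles τ := by
  have hsup : evenInvariants τ ⊔ oddInvariants τ = invariants {τ} := by
    apply le_antisymm (sup_le inf_le_right inf_le_right)
    intro f hf
    rw [mem_invariants_singleton] at hf
    refine Submodule.mem_sup.mpr ⟨fun x => (f x + f (-x)) / 2, ?_, fun x => (f x - f (-x)) / 2,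
      ?_, ?_⟩
    · refine mem_evenInvariants.mpr ⟨fun x => ?_, fun x => ?_⟩
      · rw [neg_neg, add_comm]
      · rw [← hτ, hf, hf]
    · refine mem_oddInvariants.mpr ⟨fun x => ?_, fun x => ?_⟩
      · rw [neg_neg]; ring
      · rw [← hτ, hf, hf]
    · funext x
      simp only [Pi.add_apply]
      ring
  have hinf : evenInvariants τ ⊓ oddInvariants τ = ⊥ := by
    rw [Submodule.eq_bot_iff]
    rintro f ⟨h1, h2⟩
    funext x
    have h3 := (mem_evenInvariants.mp h1).1 x
    have h4 := (mem_oddInvariants.mp h2).1 x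
    simp only [Pi.zero_apply]
    linarith
  have h := Submodule.finrank_sup_add_finrank_inf_eq (evenInvariants τ) (oddInvariants τ)
  rw [hsup, hinf, finrank_bot, ← numCycles_eq_finrank] at h
  omega

/-- Multiplication by the sign exchanges even and odd functions. -/
theorem finrank_evenFunctions :
    Module.finrank ℚ (evenFunctions n) = Module.finrank ℚ (oddFunctions n) := by
  let s (x : SignedPt n) : ℚ := (Int.sign x.1 : ℚ)
  have hneg (x : SignedPt n) : s (-x) = -s x := by
    have : (-x).1 = -x.1 := rfl
    simp only [s, this, Int.sign_neg, Int.cast_neg]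
  have hsq (x : SignedPt n) : s x * s x = 1 := by
    rcases lt_or_gt_of_ne x.2.1 with h | h
    · simp [s, Int.sign_eq_neg_one_of_neg h]
    · simp [s, Int.sign_eq_one_of_pos h]
  let m : (SignedPt n → ℚ) →ₗ[ℚ] (SignedPt n → ℚ) := LinearMap.mulLeft ℚ s
  have hm (f : SignedPt n → ℚ) (x : SignedPt n) : m f x = s x * f x := rfl
  have hmm : Function.Involutive m := fun f => by
    funext x
    rw [hm, hm, ← mul_assoc, hsq, one_mul]
  let e := LinearEquiv.ofInvolutive m hmm
  have he (f : SignedPt n → ℚ) : e f = m f := rfl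
  have : evenFunctions n = (oddFunctions n).map (e : (SignedPt n → ℚ) →ₗ[ℚ] (SignedPt n → ℚ)) := by
    ext f
    rw [Submodule.mem_map]
    constructor
    · intro hf
      refine ⟨m f, fun x => ?_, hmm f⟩
      rw [hm, hm, hneg, mem_evenFunctions.mp hf, neg_mul]
    · rintro ⟨f, hf, rfl⟩
      refine mem_evenFunctions.mpr fun x => ?_
      change m f (-x) = m f x
      rw [hm, hm, hneg, hf x, neg_mul_neg]
  rw [this]
  exact LinearEquiv.finrank_map_eq e _

theorem card_signedPt :
    Nat.card (SignedPt n) = 2 * Module.finrank ℚ (oddFunctions n) := by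
  have := Fintype.ofFinite (SignedPt n)
  have h := finrank_even_add_odd (one_mem (hyperoctahedral n))
  rw [numCycles_eq_finrank, invariants_one, finrank_top, Module.finrank_fintype_fun_eq_card,
    evenInvariants, oddInvariants, invariants_one, inf_top_eq, inf_top_eq,
    finrank_evenFunctions] at h
  rw [Nat.card_eq_fintype_card]
  omega

/-- A point `x` lies on a balanced cycle of `τ` if `-x` is in the `τ`-orbit of `x`. Odd invariants
vanish there, and on the remaining orbits up to sign they are determined by one value each. -/
theorem finrank_oddInvariants_add_card_le {τ : Perm (SignedPt n)}
    (S : Finset (SignedPt n)) (hS : ∀ x ∈ S, τ.SameCycle x (-x))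
    (hinj : Set.InjOn (orbitMk {Equiv.neg (SignedPt n), τ}) S) :
    Module.finrank ℚ (oddInvariants τ) + S.card ≤ Module.finrank ℚ (evenInvariants τ) := by
  classical
  have := Fintype.ofFinite (OrbitSpace {Equiv.neg (SignedPt n), τ})
  set mk := orbitMk {Equiv.neg (SignedPt n), τ}
  let T := S.image mk
  have hsq {f : SignedPt n → ℚ} (hf : f ∈ oddInvariants τ) :
      (fun x => f x * f x) ∈ invariants {Equiv.neg (SignedPt n), τ} := by
    rw [mem_oddInvariants] at hf
    refine mem_invariants_pair.mpr ⟨fun x => ?_, fun x => ?_⟩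
    · rw [SignedPt.neg_apply_eq, hf.1, neg_mul_neg]
    · rw [hf.2]
  have hzero {f : SignedPt n → ℚ} (hf : f ∈ oddInvariants τ) {x y : SignedPt n}
      (h : mk x = mk y) (hy : f y = 0) : f x = 0 := by
    have := apply_eq_of_orbitMk_eq (hsq hf) h
    simpa [hy] using this
  have hbal {f : SignedPt n → ℚ} (hf : f ∈ oddInvariants τ) {x : SignedPt n} (hx : x ∈ S) :
      f x = 0 := by
    obtain ⟨i, hi⟩ := hS x hx
    have h1 := apply_smul_of_mem_invariants hf.2
      (zpow_mem (Subgroup.subset_closure (Set.mem_singleton τ)) i) x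
    rw [hi, (mem_oddInvariants.mp hf).1] at h1
    linarith
  let ψ : oddInvariants τ →ₗ[ℚ] ({q // q ∈ Tᶜ} → ℚ) :=
    (LinearMap.funLeft ℚ ℚ fun q : {q // q ∈ Tᶜ} => q.1.out).domRestrict _
  have hψ : Function.Injective ψ := by
    rw [← LinearMap.ker_eq_bot, Submodule.eq_bot_iff]
    rintro ⟨f, hf⟩ h0
    refine Subtype.ext (funext fun x => ?_)
    by_cases hx : mk x ∈ T
    · obtain ⟨y, hy, hyx⟩ := Finset.mem_image.mp hx
      exact hzero hf hyx.symm (hbal hf hy)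
    · refine hzero hf (Quotient.out_eq (mk x)).symm ?_
      exact congrFun (LinearMap.mem_ker.mp h0) ⟨mk x, Finset.mem_compl.mpr hx⟩
  have h1 := LinearMap.finrank_le_finrank_of_injective hψ
  rw [Module.finrank_fintype_fun_eq_card, Fintype.card_coe, Finset.card_compl,
    Finset.card_image_of_injOn hinj] at h1
  have h2 := numOrbits_closure {Equiv.neg (SignedPt n), τ}
  rw [invariants_pair] at h2
  change _ = Module.finrank ℚ (evenInvariants τ) at h2
  have h3 : numOrbits (Subgroup.closure {Equiv.neg (SignedPt n), τ}) =
      Fintype.card (OrbitSpace {Equiv.neg (SignedPt n), τ}) := Nat.card_eq_fintype_card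
  have h4 : S.card ≤ Fintype.card (OrbitSpace {Equiv.neg (SignedPt n), τ}) := by
    rw [← Finset.card_image_of_injOn hinj]
    exact Finset.card_le_univ _
  omega

end Parity

/-! ### The reflection length -/

section Length

variable {n : ℕ}

theorem apply_swap_of_eq {X Y : Type*} [DecidableEq X] {f : X → Y} {a b : X} (h : f a = f b)
    (z : X) : f (swap a b z) = f z := by
  rw [swap_apply_def]
  split_ifs with h1 h2
  · rw [h1, h]
  · rw [h2, h]
  · rfl

theorem apply_swap_mul_swap_neg {f : SignedPt n → ℚ} (hf : f ∈ oddFunctions n) {x y : SignedPt n}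
    (h : f x = f y) (z : SignedPt n) : f ((swap x y * swap (-x) (-y)) z) = f z := by
  rw [Perm.mul_apply, apply_swap_of_eq h, apply_swap_of_eq (f := f) (by rw [hf x, hf y, h])]

/-- For each reflection there is one linear condition `f a = f b` under which an odd function `f` is
invariant. -/
theorem exists_pair_of_mem_reflectionsB {r : hyperoctahedral n} (hr : r ∈ reflectionsB n) :
    ∃ a b : SignedPt n, ∀ f ∈ oddFunctions n, f a = f b →
      ∀ x, f ((r : Perm (SignedPt n)) x) = f x := by
  rcases hr with (⟨i, j, -, -, h⟩ | ⟨i, j, -, -, h⟩) | ⟨i, -, h⟩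
  · refine ⟨i, j, fun f hf hij x => ?_⟩
    rw [h, apply_swap_mul_swap_neg hf hij]
  · refine ⟨i, -j, fun f hf hij x => ?_⟩
    have := apply_swap_mul_swap_neg hf hij x
    rwa [neg_neg, ← h] at this
  · refine ⟨i, -i, fun f hf hij x => ?_⟩
    rw [h, apply_swap_of_eq hij]

theorem swap_mul_swap_neg_comm (x y : SignedPt n) (h : y ≠ -x) :
    swap x y * swap (-x) (-y) = swap (-x) (-y) * swap x y := by
  by_cases hxy : x = y
  · rw [hxy, swap_self, swap_self]
  · refine (Perm.disjoint_swap_swap ?_).commute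
    have h1 := x.neg_ne
    have h2 := y.neg_ne
    have h3 : x ≠ -y := fun h' => h (by rw [h', neg_neg])
    simp [hxy, h1.symm, h2.symm, h3, h]

theorem neg_swap_apply (x y z : SignedPt n) : swap (-x) (-y) (-z) = -swap x y z := by
  simp only [swap_apply_def, neg_inj]
  split_ifs <;> rfl

theorem swap_mul_swap_neg_mem (x y : SignedPt n) (h : y ≠ -x) :
    swap x y * swap (-x) (-y) ∈ hyperoctahedral n := by
  intro i
  conv_lhs => rw [swap_mul_swap_neg_comm x y h, Perm.mul_apply]
  rw [Perm.mul_apply, ← neg_swap_apply, ← neg_swap_apply (-x), neg_neg, neg_neg]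

theorem swap_neg_mem (x : SignedPt n) : swap x (-x) ∈ hyperoctahedral n := by
  intro i
  rw [← neg_swap_apply, neg_neg, swap_comm]

/-- For points `x ≠ y` there is a reflection that sends `y` to `x` and fixes every odd function
with `f x = f y`. -/
theorem exists_mem_reflectionsB (x y : SignedPt n) (hxy : x ≠ y) :
    ∃ r ∈ reflectionsB n, (r : Perm (SignedPt n)) y = x ∧
      ∀ f ∈ oddFunctions n, f x = f y → ∀ z, f ((r : Perm (SignedPt n)) z) = f z := by
  have hneg (z : SignedPt n) : (-z).1 = -z.1 := rfl
  by_cases h : y = -x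
  · subst h
    refine ⟨⟨swap x (-x), swap_neg_mem x⟩, Or.inr ?_, swap_apply_right _ _, fun f hf hxy z => ?_⟩
    · rcases lt_or_gt_of_ne x.2.1 with hx | hx
      · exact ⟨-x, by rw [hneg]; omega, by rw [neg_neg]; exact swap_comm _ _⟩
      · exact ⟨x, hx, rfl⟩
    · exact apply_swap_of_eq hxy z
  · refine ⟨⟨_, swap_mul_swap_neg_mem x y h⟩, Or.inl ?_, ?_, fun f hf hxy z => ?_⟩
    · have h1 : x.1 ≠ y.1 := fun h' => hxy (Subtype.ext h')
      have h2 : y.1 ≠ -x.1 := fun h' => h (Subtype.ext h')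
      rcases lt_or_gt_of_ne x.2.1 with hx | hx <;> rcases lt_or_gt_of_ne y.2.1 with hy | hy
      · left
        rcases lt_or_gt_of_ne h1 with h3 | h3
        · refine ⟨-y, -x, by rw [hneg]; omega, by rw [hneg, hneg]; omega, ?_⟩
          simp only [neg_neg]
          rw [swap_mul_swap_neg_comm x y h, swap_comm (-x), swap_comm x]
        · refine ⟨-x, -y, by rw [hneg]; omega, by rw [hneg, hneg]; omega, ?_⟩
          simp only [neg_neg]
          rw [swap_mul_swap_neg_comm x y h]
      · right
        rcases lt_or_gt_of_ne h2 with h3 | h3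
        · refine ⟨y, -x, hy, by rw [hneg]; omega, ?_⟩
          simp only [neg_neg]
          rw [swap_comm y, swap_comm (-y)]
        · refine ⟨-x, y, by rw [hneg]; omega, by rw [hneg]; omega, ?_⟩
          simp only [neg_neg]
          rw [swap_mul_swap_neg_comm x y h]
      · right
        rcases lt_or_gt_of_ne h2 with h3 | h3
        · refine ⟨x, -y, hx, by rw [hneg]; omega, ?_⟩
          simp only [neg_neg]
        · refine ⟨-y, x, by rw [hneg]; omega, by rw [hneg]; omega, ?_⟩
          simp only [neg_neg]
          rw [swap_mul_swap_neg_comm x y h, swap_comm (-x), swap_comm x]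
      · left
        rcases lt_or_gt_of_ne h1 with h3 | h3
        · exact ⟨x, y, hx, h3, rfl⟩
        · refine ⟨y, x, hy, h3, ?_⟩
          change swap x y * swap (-x) (-y) = _
          rw [swap_comm x, swap_comm (-x)]
    · change (swap x y * swap (-x) (-y)) y = x
      have h3 : y ≠ -y := y.neg_ne.symm
      rw [Perm.mul_apply, swap_apply_of_ne_of_ne h h3, swap_apply_right]
    · exact apply_swap_mul_swap_neg hf hxy z

theorem inv_mem_reflectionsB {r : hyperoctahedral n} (hr : r ∈ reflectionsB n) :
    r⁻¹ ∈ reflectionsB n := by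
  have key {x y : SignedPt n} (h : y ≠ -x) :
      (swap x y * swap (-x) (-y))⁻¹ = swap x y * swap (-x) (-y) := by
    rw [mul_inv_rev, swap_inv, swap_inv, swap_mul_swap_neg_comm x y h]
  have hneg (z : SignedPt n) : (-z).1 = -z.1 := rfl
  rcases hr with (⟨i, j, hi, hij, h⟩ | ⟨i, j, hi, hij, h⟩) | ⟨i, hi, h⟩
  · refine Or.inl (Or.inl ⟨i, j, hi, hij, ?_⟩)
    rw [Subgroup.coe_inv, h, key]
    intro h'
    rw [h', hneg] at hij
    omega
  · refine Or.inl (Or.inr ⟨i, j, hi, hij, ?_⟩)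
    have h1 := key (x := i) (y := -j) fun h' => by
      rw [neg_inj.mp h'] at hij
      omega
    rw [neg_neg] at h1
    rw [Subgroup.coe_inv, h, h1]
  · exact Or.inr ⟨i, hi, by rw [Subgroup.coe_inv, h, swap_inv]⟩

theorem finrank_inf_ker_le {V : Type*} [AddCommGroup V] [Module ℚ V] [FiniteDimensional ℚ V]
    (W : Submodule ℚ V) (l : V →ₗ[ℚ] ℚ) :
    Module.finrank ℚ W ≤ Module.finrank ℚ ↥(W ⊓ l.ker) + 1 := by
  have h1 := LinearMap.finrank_range_add_finrank_ker (l.domRestrict W)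
  have h2 : Module.finrank ℚ (l.domRestrict W).range ≤ 1 :=
    (Submodule.finrank_le _).trans (Module.finrank_self ℚ).le
  have h3 : (l.domRestrict W).ker.map W.subtype ≤ W ⊓ l.ker := by
    rintro _ ⟨⟨v, hv⟩, hv0, rfl⟩
    exact ⟨hv, hv0⟩
  have h4 := Submodule.finrank_mono h3
  rw [Submodule.finrank_map_subtype_eq] at h4
  omega

/-- A reflection is determined on odd functions by one linear condition, so multiplying by it
lowers the dimension of the odd invariants by at most one. -/
theorem finrank_oddInvariants_le_mul {r : hyperoctahedral n} (hr : r ∈ reflectionsB n)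
    (τ : hyperoctahedral n) :
    Module.finrank ℚ (oddInvariants (τ : Perm (SignedPt n))) ≤
      Module.finrank ℚ (oddInvariants ((r * τ : hyperoctahedral n) : Perm (SignedPt n))) + 1 := by
  obtain ⟨a, b, hab⟩ := exists_pair_of_mem_reflectionsB hr
  let l : (SignedPt n → ℚ) →ₗ[ℚ] ℚ :=
    LinearMap.proj (R := ℚ) (φ := fun _ => ℚ) a - LinearMap.proj b
  refine (finrank_inf_ker_le _ l).trans (Nat.add_le_add_right (Submodule.finrank_mono ?_) 1)
  rintro f ⟨hf, hl⟩
  refine mem_oddInvariants.mpr ⟨hf.1, fun x => ?_⟩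
  have hl' : f a = f b := sub_eq_zero.mp hl
  rw [Subgroup.coe_mul, Perm.mul_apply, hab f hf.1 hl', (mem_oddInvariants.mp hf).2]

theorem oddInvariants_one : oddInvariants (1 : Perm (SignedPt n)) = oddFunctions n := by
  rw [oddInvariants, invariants_one, inf_top_eq]

theorem finrank_oddFunctions_le_length (l : List (hyperoctahedral n))
    (hl : ∀ g ∈ l, g ∈ reflectionsB n) :
    Module.finrank ℚ (oddFunctions n) ≤
      l.length + Module.finrank ℚ (oddInvariants (l.prod : Perm (SignedPt n))) := by
  induction l with
  | nil => rw [List.prod_nil, Subgroup.coe_one, oddInvariants_one, List.length_nil, zero_add]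
  | cons r l ih =>
    have h1 := ih fun g hg => hl g (List.mem_cons_of_mem _ hg)
    have h2 := finrank_oddInvariants_le_mul (hl r List.mem_cons_self) l.prod
    rw [List.prod_cons, List.length_cons]
    omega

/-- If `τ x ≠ x`, the reflection `r` sending `τ x` back to `x` keeps all odd invariants of `τ`, and
`r * τ` has the additional odd invariant `e_x - e_{-x}`. -/
theorem exists_reflection_finrank_lt (τ : hyperoctahedral n) (hτ : τ ≠ 1) :
    ∃ r ∈ reflectionsB n, Module.finrank ℚ (oddInvariants (τ : Perm (SignedPt n))) <
      Module.finrank ℚ (oddInvariants ((r * τ : hyperoctahedral n) : Perm (SignedPt n))) := by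
  obtain ⟨x, hx⟩ : ∃ x, (τ : Perm (SignedPt n)) x ≠ x := by
    by_contra! h
    exact hτ (Subtype.ext (Equiv.ext h))
  obtain ⟨r, hr, hrx, hrf⟩ := exists_mem_reflectionsB x (τ.1 x) hx.symm
  have hfix : (r * τ).1 x = x := hrx
  refine ⟨r, hr, Submodule.finrank_lt_finrank_of_lt ?_⟩
  refine SetLike.lt_iff_le_and_exists.mpr ⟨fun f hf => ?_, ?_⟩
  · rw [mem_oddInvariants] at hf
    refine mem_oddInvariants.mpr ⟨hf.1, fun z => ?_⟩
    rw [Subgroup.coe_mul, Perm.mul_apply, hrf f hf.1 (hf.2 x).symm, hf.2]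
  · refine ⟨Pi.single x 1 - Pi.single (-x) 1, mem_oddInvariants.mpr ⟨fun z => ?_, fun z => ?_⟩, ?_⟩
    · have h1 : -z = x ↔ z = -x := neg_eq_iff_eq_neg
      simp [Pi.single_apply, h1]
    · have h1 : (r * τ).1 z = x ↔ z = x := by
        conv_lhs => rw [← hfix]
        exact (r * τ).1.injective.eq_iff
      have h2 : (r * τ).1 z = -x ↔ z = -x := by
        conv_lhs => rw [← hfix, ← (r * τ).2]
        exact (r * τ).1.injective.eq_iff
      simp only [Pi.sub_apply, Pi.single_apply, h1, h2]
    · intro h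
      have h1 := (mem_oddInvariants.mp h).2 x
      simp only [Pi.sub_apply, Pi.single_apply, if_neg hx, if_neg x.neg_ne.symm, if_true] at h1
      split_ifs at h1 <;> norm_num at h1

theorem exists_reflections_prod_eq (τ : hyperoctahedral n) :
    ∃ l : List (hyperoctahedral n), (∀ g ∈ l, g ∈ reflectionsB n) ∧ l.prod = τ ∧
      l.length + Module.finrank ℚ (oddInvariants (τ : Perm (SignedPt n))) ≤
        Module.finrank ℚ (oddFunctions n) := by
  have hle (τ : Perm (SignedPt n)) :
      Module.finrank ℚ (oddInvariants τ) ≤ Module.finrank ℚ (oddFunctions n) :=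
    Submodule.finrank_mono inf_le_left
  induction hk : Module.finrank ℚ (oddFunctions n) -
    Module.finrank ℚ (oddInvariants (τ : Perm (SignedPt n))) using Nat.strong_induction_on
    generalizing τ with
  | _ k ih =>
    by_cases hτ : τ = 1
    · refine ⟨[], by simp, by simp [hτ], ?_⟩
      simpa using hle τ
    · obtain ⟨r, hr, hlt⟩ := exists_reflection_finrank_lt τ hτ
      have h1 := hle (r * τ : hyperoctahedral n)
      obtain ⟨l, hl, hprod, hlen⟩ := ih _ (by omega) (r * τ) rfl
      refine ⟨r⁻¹ :: l, ?_, by rw [List.prod_cons, hprod, inv_mul_cancel_left], ?_⟩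
      · intro g hg
        rcases List.mem_cons.mp hg with rfl | hg
        · exact inv_mem_reflectionsB hr
        · exact hl g hg
      · rw [List.length_cons]
        omega

/-- Carter's formula: the reflection length of `τ` is the codimension of its fixed space in the
reflection representation. -/
theorem lengthB_add_finrank (τ : hyperoctahedral n) :
    lengthB τ + Module.finrank ℚ (oddInvariants (τ : Perm (SignedPt n))) =
      Module.finrank ℚ (oddFunctions n) := by
  obtain ⟨l, hl, hprod, hlen⟩ := exists_reflections_prod_eq τ
  have hmem : l.length ∈ {k | ∃ l : List (hyperoctahedral n),
      l.length = k ∧ (∀ g ∈ l, g ∈ reflectionsB n) ∧ l.prod = τ} := ⟨l, rfl, hl, hprod⟩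
  have h1 : lengthB τ ≤ l.length := Nat.sInf_le hmem
  obtain ⟨l', hl', hrefl, hprod'⟩ := Nat.sInf_mem ⟨_, hmem⟩
  have h2 := finrank_oddFunctions_le_length l' hrefl
  rw [hprod'] at h2
  change l'.length = lengthB τ at hl'
  omega

theorem absLEB_iff (σ τ : hyperoctahedral n)
    (hτ : Module.finrank ℚ (oddInvariants (τ : Perm (SignedPt n))) = 0) :
    absLEB σ τ ↔ Module.finrank ℚ (oddInvariants (σ : Perm (SignedPt n))) +
      Module.finrank ℚ (oddInvariants ((σ⁻¹ * τ : hyperoctahedral n) : Perm (SignedPt n))) =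
        Module.finrank ℚ (oddFunctions n) := by
  have h1 := lengthB_add_finrank σ
  have h2 := lengthB_add_finrank τ
  have h3 := lengthB_add_finrank (σ⁻¹ * τ)
  rw [absLEB]
  omega

end Length

/-! ### The parity of balanced cycles -/

section Sign

variable {n : ℕ}

open Classical in
/-- The permutation that agrees with `τ` on the stable set `{x | A x}` and fixes its complement. -/
noncomputable def restrictTo {X : Type*} (τ : Perm X) (A : X → Prop) (hA : ∀ x, A (τ x) ↔ A x) :
    Perm X :=
  Perm.ofSubtype (τ.subtypePerm hA)

open Classical in
theorem restrictTo_apply_of_mem {X : Type*} {τ : Perm X} {A : X → Prop}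
    (hA : ∀ x, A (τ x) ↔ A x) {x : X} (hx : A x) : restrictTo τ A hA x = τ x :=
  Perm.ofSubtype_subtypePerm_of_mem hA hx

open Classical in
theorem restrictTo_apply_of_not_mem {X : Type*} {τ : Perm X} {A : X → Prop}
    (hA : ∀ x, A (τ x) ↔ A x) {x : X} (hx : ¬A x) : restrictTo τ A hA x = x :=
  Perm.ofSubtype_subtypePerm_of_not_mem hA hx

/-- If no cycle of `τ` on a symmetric stable set `A` is balanced, the cycles on `A` come in opposite
pairs `c`, `-c`. Choosing the one whose marked point is larger gives a set `P` with
`A = P ∪ -P`, so the restriction of `τ` to `A` is the product of two conjugate permutations. -/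
theorem sign_restrictTo [Fintype (SignedPt n)] {τ : Perm (SignedPt n)}
    (hτ : τ ∈ hyperoctahedral n)
    {A : SignedPt n → Prop} (hA : ∀ x, A (τ x) ↔ A x) (hneg : ∀ x, A (-x) ↔ A x)
    (hbal : ∀ x, A x → ¬τ.SameCycle x (-x)) :
    Perm.sign (restrictTo τ A hA) = 1 := by
  let mark (x : SignedPt n) : SignedPt n := (Quotient.mk (Perm.SameCycle.setoid τ) x).out
  have hmark (x : SignedPt n) : τ.SameCycle (mark x) x := 
    Quotient.mk_out (s := Perm.SameCycle.setoid τ) x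
  have hmark_apply (x : SignedPt n) : mark (τ x) = mark x := by
    have : Quotient.mk (Perm.SameCycle.setoid τ) (τ x) = Quotient.mk _ x :=
      Quotient.sound (Perm.sameCycle_apply_left.mpr (Perm.SameCycle.refl τ x))
    exact congrArg Quotient.out this
  have hne {x : SignedPt n} (hx : A x) : (mark x).1 ≠ (mark (-x)).1 := fun h =>
    hbal x hx ((hmark x).symm.trans (Subtype.ext h ▸ hmark (-x)))
  let P (x : SignedPt n) : Prop := A x ∧ (mark (-x)).1 < (mark x).1
  have hP (x : SignedPt n) : P (τ x) ↔ P x := by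
    simp only [P, hA, ← hτ x, hmark_apply]
  let ν := Equiv.neg (SignedPt n)
  have hν (x : SignedPt n) : ν x = -x := rfl
  have hν' (x : SignedPt n) : ν⁻¹ x = -x := rfl
  have hfac : restrictTo τ A hA = restrictTo τ P hP * (ν * restrictTo τ P hP * ν⁻¹) := by
    ext1 x
    simp only [Perm.mul_apply, hν, hν']
    by_cases hx : A x
    · rw [restrictTo_apply_of_mem hA hx]
      by_cases hPx : (mark (-x)).1 < (mark x).1
      · have h1 : ¬P (-x) := fun h => by
          have := h.2
          rw [neg_neg] at this
          omega
        rw [restrictTo_apply_of_not_mem hP h1, neg_neg, restrictTo_apply_of_mem hP ⟨hx, hPx⟩]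
      · have h1 : P (-x) := by
          refine ⟨(hneg x).mpr hx, ?_⟩
          have := hne hx
          rw [neg_neg]
          omega
        have h2 : ¬P (τ x) := fun h => hPx ((hP x).mp h).2
        rw [restrictTo_apply_of_mem hP h1, hτ, neg_neg, restrictTo_apply_of_not_mem hP h2]
    · have h1 : ¬P x := fun h => hx h.1
      have h2 : ¬P (-x) := fun h => hx ((hneg x).mp h.1)
      rw [restrictTo_apply_of_not_mem hA hx, restrictTo_apply_of_not_mem hP h2, neg_neg,
        restrictTo_apply_of_not_mem hP h1]
  rw [hfac, Perm.sign_mul, Perm.sign_mul, Perm.sign_mul, Perm.sign_inv]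
  have h1 := Int.units_mul_self (Perm.sign (restrictTo τ P hP))
  have h2 := Int.units_mul_self (Perm.sign ν)
  rw [mul_comm (Perm.sign ν), mul_assoc, h2, mul_one, h1]

theorem restrictTo_mul {X : Type*} {σ τ : Perm X} {A : X → Prop} (hσ : ∀ x, A (σ x) ↔ A x)
    (hτ : ∀ x, A (τ x) ↔ A x) (hστ : ∀ x, A ((σ * τ) x) ↔ A x) :
    restrictTo (σ * τ) A hστ = restrictTo σ A hσ * restrictTo τ A hτ := by
  ext1 x
  rw [Perm.mul_apply]
  by_cases hx : A x
  · rw [restrictTo_apply_of_mem _ hx, restrictTo_apply_of_mem _ hx,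
      restrictTo_apply_of_mem _ ((hτ x).mpr hx), Perm.mul_apply]
  · rw [restrictTo_apply_of_not_mem _ hx, restrictTo_apply_of_not_mem _ hx,
      restrictTo_apply_of_not_mem _ hx]

/-- If two permutations in `B_n` have no balanced cycle on a symmetric stable set, the
restriction of their product to it is even. -/
theorem exists_sameCycle_neg [Fintype (SignedPt n)] {σ τ : Perm (SignedPt n)}
    (hσ : σ ∈ hyperoctahedral n) (hτ : τ ∈ hyperoctahedral n) {A : SignedPt n → Prop}
    (hneg : ∀ x, A (-x) ↔ A x) (hσA : ∀ x, A (σ x) ↔ A x) (hστA : ∀ x, A ((σ * τ) x) ↔ A x)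
    (hsign : Perm.sign (restrictTo (σ * τ) A hστA) = -1) :
    ∃ x, A x ∧ (σ.SameCycle x (-x) ∨ τ.SameCycle x (-x)) := by
  by_contra! h
  have hτA (x : SignedPt n) : A (τ x) ↔ A x := (hσA (τ x)).symm.trans (hστA x)
  rw [restrictTo_mul hσA hτA, Perm.sign_mul, sign_restrictTo hσ hσA hneg fun x hx => (h x hx).1,
    sign_restrictTo hτ hτA hneg fun x hx => (h x hx).2] at hsign
  exact absurd hsign (by decide)

end Sign

/-! ### The annular permutation -/

section Annular

variable {p q : ℕ}

/-- The points `±1, …, ±p` of the first circle. -/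
def IsInner (p : ℕ) {n : ℕ} (x : SignedPt n) : Prop := |x.1| ≤ p

theorem isInner_neg {n : ℕ} (x : SignedPt n) : IsInner p (-x) ↔ IsInner p x := by
  have : (-x).1 = -x.1 := rfl
  rw [IsInner, IsInner, this, abs_neg]

/-- The list `1, …, p`. -/
def innerList (p q : ℕ) : List (SignedPt (p + q)) :=
  (List.finRange p).map fun k => SignedPt.pos (Fin.castAdd q k)

/-- The list `p + 1, …, p + q`. -/
def outerList (p q : ℕ) : List (SignedPt (p + q)) :=
  (List.finRange q).map fun k => SignedPt.pos (Fin.natAdd p k)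

theorem annularGamma_eq :
    annularGamma p q = signedCycle (innerList p q) * signedCycle (outerList p q) :=
  rfl

/-- A list of distinct points, all of them positive. -/
structure PosNodup {n : ℕ} (l : List (SignedPt n)) : Prop where
  nodup : l.Nodup
  pos : ∀ i ∈ l, 0 < i.1

theorem PosNodup.append_neg {n : ℕ} {l : List (SignedPt n)} (hl : PosNodup l) :
    (l ++ l.map (fun i => -i)).Nodup := by
  refine hl.nodup.append (hl.nodup.map neg_injective) ?_
  intro i hi hi'
  obtain ⟨j, hj, rfl⟩ := List.mem_map.mp hi'
  have h1 : 0 < -j.1 := hl.pos _ hi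
  have h2 := hl.pos _ hj
  omega

theorem posNodup_innerList : PosNodup (innerList p q) := by
  refine ⟨(List.nodup_finRange p).map
    ((SignedPt.pos_injective _).comp (Fin.castAdd_injective p q)), fun i hi => ?_⟩
  obtain ⟨k, -, rfl⟩ := List.mem_map.mp hi
  exact Int.natCast_succ_pos _

theorem posNodup_outerList : PosNodup (outerList p q) := by
  refine ⟨(List.nodup_finRange q).map
    ((SignedPt.pos_injective _).comp (Fin.natAdd_injective q p)), fun i hi => ?_⟩
  obtain ⟨k, -, rfl⟩ := List.mem_map.mp hi
  exact Int.natCast_succ_pos _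

theorem mem_append_map_neg {n : ℕ} {l : List (SignedPt n)} {x : SignedPt n} :
    x ∈ l ++ l.map (fun i => -i) ↔ x ∈ l ∨ -x ∈ l := by
  rw [List.mem_append, List.mem_map]
  refine or_congr_right ⟨?_, fun h => ⟨-x, h, neg_neg x⟩⟩
  rintro ⟨a, ha, rfl⟩
  rwa [neg_neg]

theorem mem_innerList {x : SignedPt (p + q)} : x ∈ innerList p q ↔ 0 < x.1 ∧ x.1 ≤ p := by
  rw [innerList, List.mem_map]
  constructor
  · rintro ⟨k, -, rfl⟩
    have h := k.2
    change 0 < ((k : ℕ) : ℤ) + 1 ∧ ((k : ℕ) : ℤ) + 1 ≤ p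
    omega
  · rintro ⟨h1, h2⟩
    refine ⟨⟨(x.1 - 1).toNat, by omega⟩, List.mem_finRange _, Subtype.ext ?_⟩
    change (((x.1 - 1).toNat : ℕ) : ℤ) + 1 = x.1
    omega

theorem mem_outerList {x : SignedPt (p + q)} : x ∈ outerList p q ↔ (p : ℤ) < x.1 := by
  rw [outerList, List.mem_map]
  constructor
  · rintro ⟨k, -, rfl⟩
    change (p : ℤ) < ((p + k : ℕ) : ℤ) + 1
    omega
  · intro h1
    have h2 := (abs_le.mp x.2.2).2
    push_cast at h2
    refine ⟨⟨(x.1 - 1).toNat - p, by omega⟩, List.mem_finRange _, Subtype.ext ?_⟩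
    change ((p + ((x.1 - 1).toNat - p) : ℕ) : ℤ) + 1 = x.1
    omega

theorem mem_innerList_or {x : SignedPt (p + q)} :
    (x ∈ innerList p q ∨ -x ∈ innerList p q) ↔ IsInner p x := by
  have h : (-x).1 = -x.1 := rfl
  have h2 := x.2.1
  rw [mem_innerList, mem_innerList, h, IsInner, abs_le]
  omega

theorem mem_outerList_or {x : SignedPt (p + q)} :
    (x ∈ outerList p q ∨ -x ∈ outerList p q) ↔ ¬IsInner p x := by
  have h : (-x).1 = -x.1 := rfl
  rw [mem_outerList, mem_outerList, h, IsInner, abs_le]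
  omega

theorem length_innerList : (innerList p q).length = p := by
  rw [innerList, List.length_map, List.length_finRange]

theorem length_outerList : (outerList p q).length = q := by
  rw [outerList, List.length_map, List.length_finRange]

theorem PosNodup.isCycle {n : ℕ} {l : List (SignedPt n)} (hl : PosNodup l) (h : 0 < l.length) :
    (signedCycle l).IsCycle := by
  refine List.isCycle_formPerm hl.append_neg ?_
  rw [List.length_append, List.length_map]
  omega

theorem PosNodup.apply_ne_self_iff {n : ℕ} {l : List (SignedPt n)} (hl : PosNodup l)
    {x : SignedPt n} : signedCycle l x ≠ x ↔ x ∈ l ∨ -x ∈ l := by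
  have h := List.support_formPerm_of_nodup' _ hl.append_neg fun x h => by
    have := congrArg List.length h
    rw [List.length_append, List.length_map, List.length_singleton] at this
    omega
  have h2 := Set.ext_iff.mp h x
  rw [Finset.mem_coe, List.mem_toFinset, mem_append_map_neg] at h2
  exact h2

theorem PosNodup.sign {n : ℕ} [Fintype (SignedPt n)] {l : List (SignedPt n)} (hl : PosNodup l)
    (h : 0 < l.length) : Perm.sign (signedCycle l) = -1 := by
  rw [(hl.isCycle h).sign, signedCycle, List.support_formPerm_of_nodup _ hl.append_neg,
    List.toFinset_card_of_nodup hl.append_neg, List.length_append, List.length_map, ← two_mul,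
    pow_mul, neg_one_sq, one_pow]
  intro x h
  have := congrArg List.length h
  rw [List.length_append, List.length_map, List.length_singleton] at this
  omega

theorem signedCycle_innerList_apply_ne {x : SignedPt (p + q)} :
    signedCycle (innerList p q) x ≠ x ↔ IsInner p x :=
  posNodup_innerList.apply_ne_self_iff.trans mem_innerList_or

theorem signedCycle_outerList_apply_ne {x : SignedPt (p + q)} :
    signedCycle (outerList p q) x ≠ x ↔ ¬IsInner p x :=
  posNodup_outerList.apply_ne_self_iff.trans mem_outerList_or

theorem disjoint_signedCycles :
    (signedCycle (innerList p q)).Disjoint (signedCycle (outerList p q)) := by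
  intro x
  by_cases hx : IsInner p x
  · exact Or.inr (not_not.mp (mt signedCycle_outerList_apply_ne.mp (not_not.mpr hx)))
  · exact Or.inl (not_not.mp (mt signedCycle_innerList_apply_ne.mp hx))

theorem Equiv.Perm.SameCycle.of_disjoint_mul {X : Type*} {σ τ : Perm X} (h : σ.Disjoint τ)
    {x y : X} (hτ : τ x = x) (hxy : σ.SameCycle x y) : (σ * τ).SameCycle x y := by
  obtain ⟨i, hi⟩ := hxy
  refine ⟨i, ?_⟩
  rw [h.commute.mul_zpow, Perm.mul_apply, Perm.zpow_apply_eq_self_of_apply_eq_self hτ, hi]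

theorem annularGamma_sameCycle (hp : 0 < p) (hq : 0 < q) {x y : SignedPt (p + q)}
    (h : IsInner p x ↔ IsInner p y) : (annularGamma p q).SameCycle x y := by
  rw [annularGamma_eq]
  by_cases hx : IsInner p x
  · refine .of_disjoint_mul disjoint_signedCycles
      (not_not.mp (mt signedCycle_outerList_apply_ne.mp (not_not.mpr hx)))
      ((posNodup_innerList.isCycle ?_).sameCycle (signedCycle_innerList_apply_ne.mpr hx)
        (signedCycle_innerList_apply_ne.mpr (h.mp hx)))
    rwa [length_innerList]
  · rw [disjoint_signedCycles.commute.eq]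
    refine .of_disjoint_mul disjoint_signedCycles.symm
      (not_not.mp (mt signedCycle_innerList_apply_ne.mp hx))
      ((posNodup_outerList.isCycle ?_).sameCycle (signedCycle_outerList_apply_ne.mpr hx)
        (signedCycle_outerList_apply_ne.mpr fun hy => hx (h.mpr hy)))
    rwa [length_outerList]

theorem annularGamma_apply_of_isInner {x : SignedPt (p + q)} (hx : IsInner p x) :
    annularGamma p q x = signedCycle (innerList p q) x := by
  rw [annularGamma_eq, Perm.mul_apply,
    not_not.mp (mt signedCycle_outerList_apply_ne.mp (not_not.mpr hx))]

theorem isInner_annularGamma (x : SignedPt (p + q)) :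
    IsInner p (annularGamma p q x) ↔ IsInner p x := by
  have key {x : SignedPt (p + q)} : IsInner p (signedCycle (innerList p q) x) ↔ IsInner p x := by
    rw [← signedCycle_innerList_apply_ne, ← signedCycle_innerList_apply_ne,
      (signedCycle (innerList p q)).injective.ne_iff]
  rw [annularGamma_eq, Perm.mul_apply, key, ← not_iff_not, ← signedCycle_outerList_apply_ne,
    ← signedCycle_outerList_apply_ne, (signedCycle (outerList p q)).injective.ne_iff]

theorem restrictTo_annularGamma :
    restrictTo (annularGamma p q) (IsInner p) isInner_annularGamma =
      signedCycle (innerList p q) := by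
  ext1 x
  by_cases hx : IsInner p x
  · rw [restrictTo_apply_of_mem _ hx, annularGamma_apply_of_isInner hx]
  · rw [restrictTo_apply_of_not_mem _ hx,
      not_not.mp (mt signedCycle_innerList_apply_ne.mp hx)]

theorem annularGamma_apply_of_not_isInner {x : SignedPt (p + q)} (hx : ¬IsInner p x) :
    annularGamma p q x = signedCycle (outerList p q) x := by
  rw [annularGamma_eq, disjoint_signedCycles.commute.eq, Perm.mul_apply,
    not_not.mp (mt signedCycle_innerList_apply_ne.mp hx)]

theorem restrictTo_annularGamma_outer :
    restrictTo (annularGamma p q) (fun x => ¬IsInner p x)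
      (fun x => not_congr (isInner_annularGamma x)) = signedCycle (outerList p q) := by
  ext1 x
  by_cases hx : IsInner p x
  · rw [restrictTo_apply_of_not_mem (A := fun x => ¬IsInner p x) _ (not_not.mpr hx),
      not_not.mp (mt signedCycle_outerList_apply_ne.mp (not_not.mpr hx))]
  · rw [restrictTo_apply_of_mem (A := fun x => ¬IsInner p x) _ hx,
      annularGamma_apply_of_not_isInner hx]

end Annular

/-! ### Counting invariants against the annular permutation -/

section Main

variable {p q : ℕ}

theorem apply_eq_of_mem_invariants_annularGamma (hp : 0 < p) (hq : 0 < q)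
    {f : SignedPt (p + q) → ℚ} (hf : f ∈ invariants {annularGamma p q}) {x y : SignedPt (p + q)}
    (h : IsInner p x ↔ IsInner p y) : f x = f y := by
  obtain ⟨i, hi⟩ := annularGamma_sameCycle hp hq h
  rw [← hi, apply_smul_of_mem_invariants hf
    (zpow_mem (Subgroup.subset_closure (Set.mem_singleton _)) i)]

theorem oddInvariants_annularGamma (hp : 0 < p) (hq : 0 < q) :
    oddInvariants (annularGamma p q) = ⊥ := by
  rw [Submodule.eq_bot_iff]
  intro f hf
  funext x
  have h1 := apply_eq_of_mem_invariants_annularGamma hp hq hf.2 (isInner_neg x)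
  have h2 := (mem_oddInvariants.mp hf).1 x
  rw [Pi.zero_apply]
  linarith

theorem exists_isInner (hp : 0 < p) : ∃ x : SignedPt (p + q), IsInner p x :=
  ⟨⟨1, one_ne_zero, by rw [abs_one]; omega⟩, by
    change |(1 : ℤ)| ≤ p
    rw [abs_one]; omega⟩

theorem exists_not_isInner (hq : 0 < q) : ∃ x : SignedPt (p + q), ¬IsInner p x := by
  have h : |(p : ℤ) + 1| = p + 1 := abs_of_nonneg (by omega)
  exact ⟨⟨p + 1, by omega, by rw [h]; omega⟩, by
    change ¬|(p : ℤ) + 1| ≤ p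
    rw [h]; omega⟩

theorem finrank_invariants_eq_two (hp : 0 < p) (hq : 0 < q) {S : Set (Perm (SignedPt (p + q)))}
    (hγ : annularGamma p q ∈ S) (hS : ∀ σ ∈ S, ∀ x, IsInner p (σ x) ↔ IsInner p x) :
    Module.finrank ℚ (invariants S) = 2 := by
  classical
  have hg : Function.Surjective fun x : SignedPt (p + q) => decide (IsInner p x) := by
    intro b
    cases b
    · exact (exists_not_isInner hq).imp fun x hx => decide_eq_false hx
    · exact (exists_isInner hp).imp fun x hx => decide_eq_true hx
  rw [finrank_invariants_eq_card hg fun σ hσ x => decide_eq_decide.mpr (hS σ hσ x)]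
  · simp
  · intro f hf x y hxy
    refine apply_eq_of_mem_invariants_annularGamma hp hq ?_ (decide_eq_decide.mp hxy)
    exact mem_invariants_singleton.mpr (hf _ hγ)

theorem finrank_invariants_eq_one (hp : 0 < p) (hq : 0 < q) {τ : Perm (SignedPt (p + q))}
    {z : SignedPt (p + q)} (hz : ¬(IsInner p (τ z) ↔ IsInner p z)) :
    Module.finrank ℚ (invariants {τ, annularGamma p q}) = 1 := by
  have hg : Function.Surjective fun _ : SignedPt (p + q) => () := fun _ => ⟨z, rfl⟩
  rw [finrank_invariants_eq_card hg fun _ _ _ => rfl]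
  · simp
  · intro f hf
    have h1 := (mem_invariants_pair.mp hf).1 z
    have h2 {x y : SignedPt (p + q)} : (IsInner p x ↔ IsInner p y) → f x = f y :=
      apply_eq_of_mem_invariants_annularGamma hp hq
        (mem_invariants_singleton.mpr (mem_invariants_pair.mp hf).2)
    have h3 (x : SignedPt (p + q)) : f x = f z := by
      by_cases hx : IsInner p x ↔ IsInner p z
      · exact h2 hx
      · rw [← h1]
        exact h2 (by tauto)
    intro x y _
    rw [h3 x, h3 y]

/-- If `σ` and `τ` in `B_n` have product `γ`, the number of balanced cycles of `σ` and `τ` together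
is at least `2 (k - 1)`, where `k` is the number of orbits of the group generated by `σ` and `γ`.
For `k = 2` the two circles are stable; on each of them `γ` is an odd permutation, so `σ` or `τ` has
a balanced cycle there. -/
theorem finrank_odd_le_finrank_even (hp : 0 < p) (hq : 0 < q) {σ τ : Perm (SignedPt (p + q))}
    (hσ : σ ∈ hyperoctahedral (p + q)) (hτ : τ ∈ hyperoctahedral (p + q))
    (hγ : σ * τ = annularGamma p q) :
    Module.finrank ℚ (oddInvariants σ) + Module.finrank ℚ (oddInvariants τ) +
        2 * Module.finrank ℚ (invariants {σ, annularGamma p q}) ≤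
      Module.finrank ℚ (evenInvariants σ) + Module.finrank ℚ (evenInvariants τ) + 2 := by
  classical
  by_cases hA : ∀ x, IsInner p (σ x) ↔ IsInner p x
  · have hγA : ∀ x, IsInner p ((σ * τ) x) ↔ IsInner p x := hγ ▸ isInner_annularGamma
    have hτA (x : SignedPt (p + q)) : IsInner p (τ x) ↔ IsInner p x :=
      (hA (τ x)).symm.trans (hγA x)
    have := Fintype.ofFinite (SignedPt (p + q))
    obtain ⟨x, hx, hx'⟩ := exists_sameCycle_neg hσ hτ isInner_neg hA hγA (by
      simp only [hγ]
      rw [restrictTo_annularGamma, posNodup_innerList.sign (by rwa [length_innerList])])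
    obtain ⟨y, hy, hy'⟩ := exists_sameCycle_neg (A := fun x => ¬IsInner p x) hσ hτ
      (fun x => not_congr (isInner_neg x)) (fun x => not_congr (hA x))
      (fun x => not_congr (hγA x)) (by
        simp only [hγ]
        rw [restrictTo_annularGamma_outer, posNodup_outerList.sign (by rwa [length_outerList])])
    let T : Finset (SignedPt (p + q)) := {x, y}
    have hxy : x ≠ y := fun h => hy (h ▸ hx)
    -- The indicator function of the inner circle separates the orbits of `x` and `y`.
    have hinj {ρ : Perm (SignedPt (p + q))} (hρ : ∀ x, IsInner p (ρ x) ↔ IsInner p x) :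
        Set.InjOn (orbitMk {Equiv.neg (SignedPt (p + q)), ρ}) T := by
      have h1 : (fun x => if IsInner p x then (1 : ℚ) else 0) ∈
          invariants {Equiv.neg (SignedPt (p + q)), ρ} :=
        mem_invariants_pair.mpr ⟨fun x => by simp [SignedPt.neg_apply_eq, isInner_neg],
          fun x => by simp [hρ]⟩
      have h2 : orbitMk {Equiv.neg (SignedPt (p + q)), ρ} x ≠ orbitMk {Equiv.neg _, ρ} y := by
        intro h
        have := apply_eq_of_orbitMk_eq h1 h
        simp [hx, hy] at this
      simp only [T, Finset.coe_insert, Finset.coe_singleton]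
      rintro a (rfl | rfl) b (rfl | rfl) h
      · rfl
      · exact absurd h h2
      · exact absurd h.symm h2
      · rfl
    have key {ρ : Perm (SignedPt (p + q))} (hρ : ∀ x, IsInner p (ρ x) ↔ IsInner p x) :=
      finrank_oddInvariants_add_card_le (T.filter fun x => ρ.SameCycle x (-x))
        (fun x hx => (Finset.mem_filter.mp hx).2)
        ((hinj hρ).mono (Finset.coe_subset.mpr (Finset.filter_subset _ _)))
    have h1 := key hA
    have h2 := key hτA
    have h3 : T ⊆ T.filter (fun x => σ.SameCycle x (-x)) ∪
        T.filter (fun x => τ.SameCycle x (-x)) := by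
      rw [← Finset.filter_or]
      intro a ha
      refine Finset.mem_filter.mpr ⟨ha, ?_⟩
      rcases Finset.mem_insert.mp ha with rfl | ha
      · exact hx'
      · rwa [Finset.mem_singleton.mp ha]
    have h4 := (Finset.card_le_card h3).trans (Finset.card_union_le _ _)
    have h5 : T.card = 2 := Finset.card_pair hxy
    have h6 := finrank_invariants_eq_two hp hq (S := {σ, annularGamma p q})
      (Set.mem_insert_of_mem _ rfl) (by
        rintro ρ (rfl | rfl)
        · exact hA
        · exact isInner_annularGamma)
    omega
  · push Not at hA
    obtain ⟨z, hz⟩ := hA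
    have h1 := finrank_invariants_eq_one hp hq (τ := σ) (z := z) (by tauto)
    have h2 := finrank_oddInvariants_add_card_le (τ := σ) ∅ (by simp) (by simp)
    have h3 := finrank_oddInvariants_add_card_le (τ := τ) ∅ (by simp) (by simp)
    rw [Finset.card_empty] at h2 h3
    omega

theorem mem_nonCrossing_annularGamma_iff (hp : 0 < p) (hq : 0 < q)
    {τ : Perm (SignedPt (p + q))} (hτ : τ ∈ hyperoctahedral (p + q)) :
    τ ∈ nonCrossing (annularGamma p q) ↔
      Module.finrank ℚ (oddInvariants τ) +
        Module.finrank ℚ (oddInvariants (τ⁻¹ * annularGamma p q)) =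
          Module.finrank ℚ (oddFunctions (p + q)) := by
  set γ := annularGamma p q
  have hγ : τ * (τ⁻¹ * γ) = γ := mul_inv_cancel_left _ _
  have hτ' : τ⁻¹ * γ ∈ hyperoctahedral (p + q) := mul_mem (inv_mem hτ) (annularGamma_mem p q)
  have hodd : Module.finrank ℚ (oddInvariants γ) = 0 := by
    rw [oddInvariants_annularGamma hp hq, finrank_bot]
  have hcγ : numCycles γ = 2 := by
    rw [numCycles_eq_finrank]
    refine finrank_invariants_eq_two hp hq rfl ?_
    rintro σ rfl
    exact isInner_annularGamma
  have heven : Module.finrank ℚ (evenInvariants γ) = 2 := by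
    have : _ + _ = numCycles γ := finrank_even_add_odd (annularGamma_mem p q)
    omega
  have hconn : evenFunctions (p + q) ⊓ invariants {τ, τ⁻¹ * γ} = invariants {τ, γ} := by
    rw [← invariants_pair_mul, hγ, inf_eq_right]
    intro f hf
    refine mem_evenFunctions.mpr fun x => ?_
    exact apply_eq_of_mem_invariants_annularGamma hp hq
      (mem_invariants_singleton.mpr (mem_invariants_pair.mp hf).2) (isInner_neg x)
  have hscott := finrank_invariants_le (evenFunctions (p + q)) τ (τ⁻¹ * γ) fun f hf => by
    rw [mem_evenFunctions] at hf ⊢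
    intro x
    rw [Function.comp_apply, Function.comp_apply, hτ, hf]
  rw [hγ, hconn, finrank_evenFunctions] at hscott
  change Module.finrank ℚ (evenInvariants τ) + Module.finrank ℚ (evenInvariants (τ⁻¹ * γ)) +
    Module.finrank ℚ (evenInvariants γ) ≤ _ at hscott
  -- An odd function invariant under both factors is an odd invariant of `γ`, hence zero.
  have hsum : Module.finrank ℚ (oddInvariants τ) + Module.finrank ℚ (oddInvariants (τ⁻¹ * γ)) ≤
      Module.finrank ℚ (oddFunctions (p + q)) := by
    have h1 : oddInvariants τ ⊓ oddInvariants (τ⁻¹ * γ) = ⊥ := by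
      rw [← le_bot_iff, ← oddInvariants_annularGamma hp hq]
      rintro f ⟨h1, h2⟩
      refine mem_oddInvariants.mpr ⟨h1.1, fun x => ?_⟩
      have h1 := (mem_oddInvariants.mp h1).2
      have h2 := (mem_oddInvariants.mp h2).2
      change f (γ x) = f x
      rw [← hγ, Perm.mul_apply, h1, h2]
    have h2 := Submodule.finrank_sup_add_finrank_inf_eq (oddInvariants τ) (oddInvariants (τ⁻¹ * γ))
    have h3 : oddInvariants τ ⊔ oddInvariants (τ⁻¹ * γ) ≤ oddFunctions (p + q) :=
      sup_le inf_le_left inf_le_left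
    rw [h1, finrank_bot] at h2
    have h4 := Submodule.finrank_mono h3
    omega
  have hbal := finrank_odd_le_finrank_even hp hq hτ hτ' hγ
  change _ + _ + 2 * Module.finrank ℚ (invariants {τ, γ}) ≤ _ at hbal
  have h1 := finrank_even_add_odd hτ
  have h2 := finrank_even_add_odd hτ'
  have h3 : Nat.card (SignedPt (p + q)) = _ := card_signedPt
  change numCycles τ + numCycles (τ⁻¹ * γ) + numCycles γ =
    Nat.card (SignedPt (p + q)) + 2 * numOrbits (Subgroup.closure {τ, γ}) ↔ _
  rw [numOrbits_closure]
  omega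

end Main

theorem theorem1p1 (p q : ℕ) (hp : 0 < p) (hq : 0 < q) :
    annularNonCrossingB p q =
      (fun τ : hyperoctahedral (p + q) => (τ : Equiv.Perm (SignedPt (p + q)))) ''
        {τ | absLEB τ ⟨annularGamma p q, annularGamma_mem p q⟩} := by
  have key (τ : hyperoctahedral (p + q)) :
      absLEB τ ⟨annularGamma p q, annularGamma_mem p q⟩ ↔
        (τ : Perm (SignedPt (p + q))) ∈ nonCrossing (annularGamma p q) := by
    rw [mem_nonCrossing_annularGamma_iff hp hq τ.2]
    refine absLEB_iff τ _ ?_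
    rw [oddInvariants_annularGamma hp hq, finrank_bot]
  ext τ
  constructor
  · rintro ⟨h1, h2⟩
    exact ⟨⟨τ, h2⟩, (key _).mpr h1, rfl⟩
  · rintro ⟨τ, h, rfl⟩
    exact ⟨(key τ).mp h, τ.2⟩
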